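/- A discrete filtered set (d.f.s.) is a family $\Omega=(\Omega_L)_{L\ge 0}$ of finite subsets of $\mathbb C$ such that $\Omega_{L_1}\subseteq\Omega_{L_2}$ whenever $L_1\le L_2$, and $\Omega_\delta=\emptyset$ for some $\delta>0$. Put $\mathcal S_\Omega=\{(\lambda,\omega)\in\mathbb R\times\mathbb C : \lambda\ge 0,\ \omega\in\Omega_\lambda\}$ and $\mathcal M_\Omega=(\mathbb R\times\mathbb C)\setminus\overline{\mathcal S_\Omega}$. A Lipschitz path $\gamma:[0,t_*]\to\mathbb C$ with $\gamma(0)=0$ is called $\Omega$-allowed if $(L(\gamma|_{[0,t]}),\gamma(t))\in\mathcal M_\Omega$ for all $t\in[0,t_*]$, where $L$ denotes length. An $\Omega$-endless Riemann surface is a triple $(X,\mathfrak p,\underline 0)$ where $X$ is a connected Riemann surface, $\mathfrak p:X\to\mathbb C$ is a local biholomorphism, $\underline 0\in\mathfrak p^{-1}(0)$, and every $\Omega$-allowed path $\gamma:[0,1]\to\mathbb C$ has a continuous lift $\underline\gamma:[0,1]\to X$ (that is, $\mathfrak p\circ\underline\gamma=\gamma$) with $\underline\gamma(0)=\underline 0$.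 A morphism $(X,\mathfrak p,\underline 0)\to(X',\mathfrak p',\underline 0')$ is a local biholomorphism $\mathfrak q:X\to X'$ with $\mathfrak p'\circ\mathfrak q=\mathfrak p$ and $\mathfrak q(\underline 0)=\underline 0'$. Theorem. For every d.f.s. $\Omega$ there exists an $\Omega$-endless Riemann surface $(X_\Omega,\mathfrak p_\Omega,\underline 0_\Omega)$ such that for every $\Omega$-endless Riemann surface $(X,\mathfrak p,\underline 0)$ there is a unique morphism $\mathfrak q:(X_\Omega,\mathfrak p_\Omega,\underline 0_\Omega)\to(X,\mathfrak p,\underline 0)$. Any $\Omega$-endless Riemann surface with this property is isomorphic to $(X_\Omega,\mathfrak p_\Omega,\underline 0_\Omega)$, and $X_\Omega$ is simply connected. -/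

import Mathlib

open Set CategoryTheory
open scoped Manifold ContDiff NNReal

universe u

/-- A discrete filtered set (d.f.s.): a family `(Ω_L)_{L ≥ 0}` of finite subsets of `ℂ`,
nondecreasing in `L`, such that `Ω_δ = ∅` for some `δ > 0`. -/
structure DiscreteFilteredSet where
  /-- the set `Ω_L` -/
  set : ℝ≥0 → Set ℂ
  finite_set : ∀ L, (set L).Finite
  mono : ∀ ⦃L₁ L₂ : ℝ≥0⦄, L₁ ≤ L₂ → set L₁ ⊆ set L₂
  exists_eq_empty : ∃ δ : ℝ≥0, 0 < δ ∧ set δ = ∅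

namespace DiscreteFilteredSet

/-- `S_Ω = {(l, w) ∈ ℝ × ℂ | l ≥ 0 and w ∈ Ω_l}`. -/
def singularSet (Ω : DiscreteFilteredSet) : Set (ℝ × ℂ) :=
  {z | ∃ h : 0 ≤ z.1, z.2 ∈ Ω.set ⟨z.1, h⟩}

/-- The allowed open set `M_Ω`: the complement in `ℝ × ℂ` of the closure of `S_Ω`. -/
def allowedSet (Ω : DiscreteFilteredSet) : Set (ℝ × ℂ) :=
  (closure Ω.singularSet)ᶜ

/-- The restriction of `γ` to `[0, T]` is an `Ω`-allowed path: it is Lipschitz, it starts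
at `0`, and `(L(γ|[0,t]), γ(t))` lies in the allowed open set for every `t ∈ [0, T]`. The
length `L` of a path is its total variation (finite for a Lipschitz path). -/
structure IsAllowedPath (Ω : DiscreteFilteredSet) (T : ℝ) (γ : ℝ → ℂ) : Prop where
  nonneg : 0 ≤ T
  lipschitz : ∃ K : ℝ≥0, LipschitzOnWith K γ (Icc 0 T)
  map_zero : γ 0 = 0
  mem_allowedSet : ∀ t ∈ Icc 0 T, ((eVariationOn γ (Icc 0 t)).toReal, γ t) ∈ Ω.allowedSet

end DiscreteFilteredSet

/-- An `Ω`-endless Riemann surface `(X, p, 0_X)`: a connected Riemann surface `X`, a local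
biholomorphism `p : X → ℂ` and a point `0_X` over `0` such that every `Ω`-allowed path
`[0, 1] → ℂ` has a continuous lift through `p` that starts at `0_X`. -/
structure EndlessRiemannSurface (Ω : DiscreteFilteredSet) : Type (u + 1) where
  /-- the underlying set of points -/
  carrier : Type u
  [topologicalSpace : TopologicalSpace carrier]
  [t2Space : T2Space carrier]
  [connectedSpace : ConnectedSpace carrier]
  [chartedSpace : ChartedSpace ℂ carrier]
  [isManifold : IsManifold 𝓘(ℂ) ω carrier]
  /-- the projection to `ℂ` -/
  proj : carrier → ℂ
  isLocalDiffeomorph_proj : IsLocalDiffeomorph 𝓘(ℂ) 𝓘(ℂ) ω proj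
  /-- the base point -/
  base : carrier
  proj_base : proj base = 0
  exists_lift : ∀ γ : ℝ → ℂ, Ω.IsAllowedPath 1 γ →
    ∃ lift : ℝ → carrier, ContinuousOn lift (Icc 0 1) ∧ lift 0 = base ∧
      ∀ t ∈ Icc (0 : ℝ) 1, proj (lift t) = γ t

namespace EndlessRiemannSurface

attribute [instance] topologicalSpace t2Space connectedSpace chartedSpace isManifold

variable {Ω : DiscreteFilteredSet}

/-- A morphism of `Ω`-endless Riemann surfaces: a local biholomorphism that commutes with
the projections to `ℂ` and preserves the base points. -/
@[ext]
structure Hom (X Y : EndlessRiemannSurface.{u} Ω) : Type u where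
  /-- the underlying map -/
  toFun : X.carrier → Y.carrier
  isLocalDiffeomorph : IsLocalDiffeomorph 𝓘(ℂ) 𝓘(ℂ) ω toFun
  proj_comp : ∀ x, Y.proj (toFun x) = X.proj x
  map_base : toFun X.base = Y.base

/-- The category of `Ω`-endless Riemann surfaces, with composition of maps. -/
instance category : Category.{u} (EndlessRiemannSurface.{u} Ω) where
  Hom := Hom
  id X :=
    { toFun := fun x => x
      isLocalDiffeomorph := (Diffeomorph.refl 𝓘(ℂ) X.carrier ω).isLocalDiffeomorph
      proj_comp := fun _ => rfl
      map_base := rfl }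
  comp {_ _ _} f g :=
    { toFun := fun x => g.toFun (f.toFun x)
      isLocalDiffeomorph := fun x =>
        (f.isLocalDiffeomorph x).comp 𝓘(ℂ) _ (g.isLocalDiffeomorph (f.toFun x))
      proj_comp := fun x => (g.proj_comp _).trans (f.proj_comp x)
      map_base := (congrArg g.toFun f.map_base).trans g.map_base }

end EndlessRiemannSurface

/-!
The universal surface is built as a quotient of the set of allowed paths: two paths are identified
if they have the same end point and if, in *every* `Ω`-endless Riemann surface `Y`, their lifts from
the base point have the same end point. Sending the class of a path to the end point of its lift
then is the required morphism to `Y`, and it is unique because lifts through a local biholomorphism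
from a connected space are determined by one value (`EndlessRiemannSurface.hom_eq`).

What makes the quotient a Riemann surface is a uniformity in `Y`. As the allowed set is open, an
allowed path `a` can be continued along all segments shorter than some `ε > 0` that depends on `a`
alone (`IsAllowedPath.exists_extendBySegment`), so every `Y` has a continuous section of its
projection over the disk of radius `ε` around the end point of `a`
(`EndlessRiemannSurface.continuousOn_localSection`). The extensions of `a` by segments therefore
define a local section of the quotient, and these sections are its charts. The quotient is
Hausdorff since two distinct points over the same point of `ℂ` are separated by some `Y`. Allowed
paths lift to the quotient by following the classes of their restrictions.

Simple connectedness follows from the universal property, applied to the universal cover of the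
universal surface `X`, that is, to the set of homotopy classes of paths in `X` from the base point.
It is again an `Ω`-endless Riemann surface, so there is a morphism `q` from `X` to it. A path `c` in
`X` from the base point to `x` has two lifts to the universal cover, the path of the classes of its
initial pieces and `q ∘ c`; they coincide, so the homotopy class of `c` is `q x`, whatever `c` is
(`EndlessRiemannSurface.homotopic_of_hom_universalCover`).

Both constructions produce a set over `ℂ` together with local sections of the projection, and
`LocalSectionSystem` turns such data into a Hausdorff Riemann surface.
-/

open Filter Topology

/-! ### Riemann surfaces spread over `ℂ`, built from local sections -/

/-- A set `Q` over `ℂ` in which every point `x` comes with a germ at `proj x` of a section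
`sec x` of `proj` passing through `x`, the germs being compatible and separated. The values of
`sec x` far from `proj x` carry no information. This is what is needed to make `Q` a Hausdorff
Riemann surface on which `proj` is a local biholomorphism. -/
structure LocalSectionSystem (Q : Type u) where
  /-- the projection to `ℂ` -/
  proj : Q → ℂ
  /-- `sec x` is a section of `proj` near `proj x` -/
  sec : Q → ℂ → Q
  sec_proj : ∀ x, sec x (proj x) = x
  proj_sec : ∀ x, ∀ᶠ z in 𝓝 (proj x), proj (sec x z) = z
  sec_sec : ∀ x, ∀ᶠ z in 𝓝 (proj x), ∀ᶠ w in 𝓝 z, sec (sec x z) w = sec x w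
  sec_ne_sec : ∀ x y, proj x = proj y → x ≠ y → ∀ᶠ z in 𝓝 (proj x), sec x z ≠ sec y z

namespace LocalSectionSystem

variable {Q : Type u} (S : LocalSectionSystem Q)

/-- A synonym of `Q` that carries the topology and the complex structure defined by `S`. -/
def Space (_ : LocalSectionSystem Q) : Type u := Q

/-- A set is open if it contains the germ of the section through each of its points. -/
instance : TopologicalSpace S.Space where
  IsOpen U := ∀ x ∈ U, ∀ᶠ z in 𝓝 (S.proj x), S.sec x z ∈ U
  isOpen_univ := fun _ _ => Eventually.of_forall fun _ => trivial
  isOpen_inter := fun _ _ hU hV x hx => (hU x hx.1).and (hV x hx.2)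
  isOpen_sUnion := fun _ h x ⟨U, hU, hx⟩ => (h U hU x hx).mono fun _ hz => ⟨U, hU, hz⟩

/-- The projection, as a map on the space defined by `S`. -/
def projSpace : S.Space → ℂ := S.proj

/-- The local section through `x`, as a map to the space defined by `S`. -/
def secSpace (x : S.Space) : ℂ → S.Space := S.sec x

lemma isOpen_iff {U : Set S.Space} :
    IsOpen U ↔ ∀ x ∈ U, ∀ᶠ z in 𝓝 (S.projSpace x), S.secSpace x z ∈ U := Iff.rfl

@[simp]
lemma secSpace_projSpace (x : S.Space) : S.secSpace x (S.projSpace x) = x := S.sec_proj x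

/-- The open set of points where `sec x` is a section and agrees with the section through each
of its values. -/
def secDomain (x : S.Space) : Set ℂ :=
  interior {z | S.projSpace (S.secSpace x z) = z ∧
    ∀ᶠ w in 𝓝 z, S.secSpace (S.secSpace x z) w = S.secSpace x w}

lemma isOpen_secDomain (x : S.Space) : IsOpen (S.secDomain x) := isOpen_interior

lemma projSpace_mem_secDomain (x : S.Space) : S.projSpace x ∈ S.secDomain x :=
  mem_interior_iff_mem_nhds.2 ((S.proj_sec x).and (S.sec_sec x))

lemma projSpace_secSpace {x : S.Space} {z : ℂ} (hz : z ∈ S.secDomain x) :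
    S.projSpace (S.secSpace x z) = z := (interior_subset hz).1

lemma secSpace_secSpace {x : S.Space} {z : ℂ} (hz : z ∈ S.secDomain x) :
    ∀ᶠ w in 𝓝 z, S.secSpace (S.secSpace x z) w = S.secSpace x w := (interior_subset hz).2

lemma continuous_projSpace : Continuous S.projSpace := by
  refine ⟨fun V hV => S.isOpen_iff.2 fun x hx => ?_⟩
  filter_upwards [hV.mem_nhds hx, S.proj_sec x] with z hz h
  exact (congrArg (· ∈ V) h).mpr hz

lemma continuousOn_secSpace (x : S.Space) : ContinuousOn (S.secSpace x) (S.secDomain x) := by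
  refine (continuousOn_open_iff (S.isOpen_secDomain x)).2 fun U hU => ?_
  refine isOpen_iff_mem_nhds.2 fun z hz => ?_
  have h := S.isOpen_iff.1 hU _ hz.2
  rw [S.projSpace_secSpace hz.1] at h
  filter_upwards [h, S.secSpace_secSpace hz.1, (S.isOpen_secDomain x).mem_nhds hz.1]
    with w hw hw' hwd
  exact ⟨hwd, show S.secSpace x w ∈ U from hw' ▸ hw⟩

lemma continuousAt_secSpace (x : S.Space) : ContinuousAt (S.secSpace x) (S.projSpace x) :=
  (S.continuousOn_secSpace x).continuousAt
    ((S.isOpen_secDomain x).mem_nhds (S.projSpace_mem_secDomain x))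

lemma isOpen_secSpace_image (x : S.Space) {V : Set ℂ} (hV : IsOpen V) (h : V ⊆ S.secDomain x) :
    IsOpen (S.secSpace x '' V) := by
  refine S.isOpen_iff.2 ?_
  rintro _ ⟨z, hz, rfl⟩
  rw [S.projSpace_secSpace (h hz)]
  filter_upwards [hV.mem_nhds hz, S.secSpace_secSpace (h hz)] with w hw hw'
  exact ⟨w, hw, hw'.symm⟩

/-- A map into `S.Space` is continuous at a point if its projection is and if, near this point,
it follows the local section. -/
lemma continuousWithinAt_of_eventually_eq {A : Type*} [TopologicalSpace A] {f : A → S.Space}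
    {s : Set A} {a : A} (hp : ContinuousWithinAt (fun b => S.projSpace (f b)) s a)
    (hf : ∀ᶠ b in 𝓝[s] a, f b = S.secSpace (f a) (S.projSpace (f b))) :
    ContinuousWithinAt f s a := by
  have h : ContinuousWithinAt (fun b => S.secSpace (f a) (S.projSpace (f b))) s a :=
    ContinuousAt.comp_continuousWithinAt (g := S.secSpace (f a)) (S.continuousAt_secSpace (f a)) hp
  exact h.congr_of_eventuallyEq hf (by simp)

instance : T2Space S.Space := by
  refine ⟨fun x y hxy => ?_⟩
  by_cases h : S.projSpace x = S.projSpace y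
  · obtain ⟨V, hVsub, hVo, hxV⟩ := _root_.mem_nhds_iff.1 (S.sec_ne_sec x y h hxy)
    have hx : S.projSpace x ∈ V := hxV
    have hy : S.projSpace y ∈ V := h ▸ hx
    refine ⟨S.secSpace x '' (V ∩ S.secDomain x), S.secSpace y '' (V ∩ S.secDomain y),
      S.isOpen_secSpace_image x (hVo.inter (S.isOpen_secDomain x)) inter_subset_right,
      S.isOpen_secSpace_image y (hVo.inter (S.isOpen_secDomain y)) inter_subset_right,
      ⟨_, ⟨hx, S.projSpace_mem_secDomain x⟩, S.secSpace_projSpace x⟩,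
      ⟨_, ⟨hy, S.projSpace_mem_secDomain y⟩, S.secSpace_projSpace y⟩,
      Set.disjoint_left.2 ?_⟩
    rintro _ ⟨z, hz, rfl⟩ ⟨w, hw, hwz⟩
    have hzw : w = z := by
      rw [← S.projSpace_secSpace hw.2, hwz, S.projSpace_secSpace hz.2]
    exact hVsub hz.1 (by subst hzw; exact hwz.symm)
  · obtain ⟨U, V, hU, hV, hxU, hyV, hd⟩ := t2_separation h
    exact ⟨_, _, hU.preimage S.continuous_projSpace, hV.preimage S.continuous_projSpace, hxU, hyV,
      hd.preimage _⟩

/-- The chart at `x`: the projection, with the local section through `x` as its inverse. -/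
noncomputable def chart (x : S.Space) : OpenPartialHomeomorph S.Space ℂ where
  toFun := S.projSpace
  invFun := S.secSpace x
  source := S.secSpace x '' S.secDomain x
  target := S.secDomain x
  map_source' := by
    rintro _ ⟨z, hz, rfl⟩
    rwa [S.projSpace_secSpace hz]
  map_target' := fun _ hz => mem_image_of_mem _ hz
  left_inv' := by
    rintro _ ⟨z, hz, rfl⟩
    rw [S.projSpace_secSpace hz]
  right_inv' := fun _ hz => S.projSpace_secSpace hz
  open_source := S.isOpen_secSpace_image x (S.isOpen_secDomain x) subset_rfl
  open_target := S.isOpen_secDomain x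
  continuousOn_toFun := S.continuous_projSpace.continuousOn
  continuousOn_invFun := S.continuousOn_secSpace x

lemma mem_chart_source (x : S.Space) : x ∈ (S.chart x).source :=
  ⟨_, S.projSpace_mem_secDomain x, S.secSpace_projSpace x⟩

noncomputable instance : ChartedSpace ℂ S.Space where
  atlas := range S.chart
  chartAt := S.chart
  mem_chart_source := S.mem_chart_source
  chart_mem_atlas := fun x => ⟨x, rfl⟩

instance : IsManifold 𝓘(ℂ) ω S.Space := by
  refine isManifold_of_contDiffOn _ _ _ ?_
  rintro _ _ ⟨x, rfl⟩ ⟨y, rfl⟩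
  -- every chart is the restriction of the projection, so the transition maps are identities
  refine (contDiff_id (𝕜 := ℂ) (E := ℂ) (n := ω)).contDiffOn.congr fun z hz => ?_
  exact S.projSpace_secSpace hz.1.1

lemma isLocalDiffeomorph_projSpace : IsLocalDiffeomorph 𝓘(ℂ) 𝓘(ℂ) ω S.projSpace := fun x =>
  ⟨{ toPartialEquiv := (S.chart x).toPartialEquiv
     open_source := (S.chart x).open_source
     open_target := (S.chart x).open_target
     contMDiffOn_toFun := contMDiffOn_chart (x := x)
     contMDiffOn_invFun := contMDiffOn_chart_symm (x := x) },
    S.mem_chart_source x, fun _ _ => rfl⟩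

end LocalSectionSystem

/-! ### Lifting through local biholomorphisms -/

lemma IsLocalDiffeomorphAt.congr_of_eventuallyEq {M N : Type*} [TopologicalSpace M]
    [ChartedSpace ℂ M] [TopologicalSpace N] [ChartedSpace ℂ N] {f g : M → N} {x : M}
    (hf : IsLocalDiffeomorphAt 𝓘(ℂ) 𝓘(ℂ) ω f x) (h : g =ᶠ[𝓝 x] f) :
    IsLocalDiffeomorphAt 𝓘(ℂ) 𝓘(ℂ) ω g x := by
  obtain ⟨Φ, hx, hΦ⟩ := hf
  obtain ⟨U, hU, hUo, hxU⟩ := _root_.mem_nhds_iff.1 h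
  let e := Φ.toOpenPartialHomeomorph.restrOpen U hUo
  have hs : e.source = Φ.source ∩ U := Φ.toOpenPartialHomeomorph.restrOpen_source U hUo
  refine ⟨{ toPartialEquiv := e.toPartialEquiv
            open_source := e.open_source
            open_target := e.open_target
            contMDiffOn_toFun := Φ.contMDiffOn_toFun.mono (hs ▸ inter_subset_left)
            contMDiffOn_invFun := Φ.contMDiffOn_invFun.mono inter_subset_left }, ?_, ?_⟩
  · change x ∈ e.source
    rw [hs]
    exact ⟨hx, hxU⟩
  · intro y hy
    have hy' : y ∈ Φ.source ∩ U := hs ▸ hy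
    exact (hU hy'.2).trans (hΦ hy'.1)

/-- A continuous map between spaces that are locally biholomorphic to `ℂ` is a local
biholomorphism as soon as it commutes with the projections. -/
lemma Continuous.isLocalDiffeomorph_of_proj_comp {M N : Type*} [TopologicalSpace M]
    [ChartedSpace ℂ M] [TopologicalSpace N] [ChartedSpace ℂ N] {f : M → N} {p : M → ℂ} {q : N → ℂ}
    (hf : Continuous f) (hp : IsLocalDiffeomorph 𝓘(ℂ) 𝓘(ℂ) ω p)
    (hq : IsLocalDiffeomorph 𝓘(ℂ) 𝓘(ℂ) ω q) (h : ∀ x, q (f x) = p x) :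
    IsLocalDiffeomorph 𝓘(ℂ) 𝓘(ℂ) ω f := by
  intro x
  have h1 := (hq (f x)).localInverse_isLocalDiffeomorphAt
  rw [h x] at h1
  refine ((hp x).comp _ _ h1).congr_of_eventuallyEq ?_
  filter_upwards [hf.continuousAt.eventually (hq (f x)).localInverse_eventuallyEq_left] with y hy
  simpa [h y] using hy.symm

namespace EndlessRiemannSurface

variable {Ω : DiscreteFilteredSet} (Y : EndlessRiemannSurface.{u} Ω)

lemma isSeparatedMap_proj : IsSeparatedMap Y.proj := T2Space.isSeparatedMap _

lemma isLocallyInjective_proj : IsLocallyInjective Y.proj :=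
  Y.isLocalDiffeomorph_proj.isLocalHomeomorph.isLocallyInjective

lemma continuous_proj : Continuous Y.proj := Y.isLocalDiffeomorph_proj.isLocalHomeomorph.continuous

/-- Two lifts of a map on a preconnected set agree as soon as they agree at one point. -/
lemma eqOn_of_proj_eq {A : Type*} [TopologicalSpace A] {s : Set A} {f g : A → Y.carrier}
    (hs : IsPreconnected s) (hf : ContinuousOn f s) (hg : ContinuousOn g s)
    (h : ∀ a ∈ s, Y.proj (f a) = Y.proj (g a)) {a : A} (ha : a ∈ s) (hfg : f a = g a) :
    EqOn f g s :=
  Y.isSeparatedMap_proj.eqOn_of_comp_eqOn Y.isLocallyInjective_proj hs hf hg h ha hfg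

/-- `l` restricts to a lift of `γ|[0,T]` that starts at the base point of `Y`. -/
structure IsLift (T : ℝ) (γ : ℝ → ℂ) (l : ℝ → Y.carrier) : Prop where
  continuousOn : ContinuousOn l (Icc 0 T)
  map_zero : l 0 = Y.base
  proj_eq : ∀ t ∈ Icc 0 T, Y.proj (l t) = γ t

variable {Y}

lemma IsLift.mono {T T' : ℝ} {γ : ℝ → ℂ} {l : ℝ → Y.carrier} (h : Y.IsLift T γ l) (hT : T' ≤ T) :
    Y.IsLift T' γ l :=
  ⟨h.continuousOn.mono (Icc_subset_Icc_right hT), h.map_zero,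
    fun t ht => h.proj_eq t (Icc_subset_Icc_right hT ht)⟩

lemma IsLift.eqOn {T : ℝ} {γ γ' : ℝ → ℂ} {l l' : ℝ → Y.carrier} (h : Y.IsLift T γ l)
    (h' : Y.IsLift T γ' l') (hγ : EqOn γ γ' (Icc 0 T)) : EqOn l l' (Icc 0 T) := by
  intro t ht
  exact Y.eqOn_of_proj_eq isPreconnected_Icc h.continuousOn h'.continuousOn
    (fun s hs => by rw [h.proj_eq s hs, h'.proj_eq s hs, hγ hs])
    (left_mem_Icc.2 (ht.1.trans ht.2)) (h.map_zero.trans h'.map_zero.symm) ht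

end EndlessRiemannSurface

/-! ### Allowed paths and their radial extensions -/

namespace DiscreteFilteredSet

variable {Ω : DiscreteFilteredSet}

lemma IsAllowedPath.mono {T T' : ℝ} {γ : ℝ → ℂ} (h : Ω.IsAllowedPath T γ) (h0 : 0 ≤ T')
    (hT : T' ≤ T) : Ω.IsAllowedPath T' γ :=
  ⟨h0, h.lipschitz.imp fun _ hK => hK.mono (Icc_subset_Icc_right hT), h.map_zero,
    fun t ht => h.mem_allowedSet t (Icc_subset_Icc_right hT ht)⟩

lemma IsAllowedPath.continuousOn {T : ℝ} {γ : ℝ → ℂ} (h : Ω.IsAllowedPath T γ) :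
    ContinuousOn γ (Icc 0 T) := h.lipschitz.choose_spec.continuousOn

lemma isOpen_allowedSet (Ω : DiscreteFilteredSet) : IsOpen Ω.allowedSet :=
  isClosed_closure.isOpen_compl

lemma zero_mem_allowedSet (Ω : DiscreteFilteredSet) : ((0 : ℝ), (0 : ℂ)) ∈ Ω.allowedSet := by
  obtain ⟨δ, hδ, hΩ⟩ := Ω.exists_eq_empty
  -- no singular point has length below `δ`, so `S_Ω` lies in the closed half space `l ≥ δ`
  have hsub : Ω.singularSet ⊆ {z | (δ : ℝ) ≤ z.1} := by
    rintro z ⟨hz, hzΩ⟩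
    by_contra hlt
    have hle : (⟨z.1, hz⟩ : ℝ≥0) ≤ δ := NNReal.coe_le_coe.1 (not_le.1 hlt).le
    exact (hΩ ▸ Ω.mono hle hzΩ : z.2 ∈ (∅ : Set ℂ))
  intro h0
  have := closure_minimal hsub (isClosed_le continuous_const continuous_fst) h0
  exact absurd this (not_le.2 (NNReal.coe_pos.2 hδ))

lemma isAllowedPath_zero (Ω : DiscreteFilteredSet) : Ω.IsAllowedPath 0 (fun _ => 0) where
  nonneg := le_rfl
  lipschitz := ⟨0, LipschitzWith.const 0 |>.lipschitzOnWith⟩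
  map_zero := rfl
  mem_allowedSet t _ := by
    have h : eVariationOn (fun _ : ℝ => (0 : ℂ)) (Icc 0 t) = 0 :=
      eVariationOn.constant_on (by rintro _ ⟨_, _, rfl⟩ _ ⟨_, _, rfl⟩; rfl)
    simpa [h] using Ω.zero_mem_allowedSet

/-- The path `γ` on `[0, T]`, followed by the segment from `γ T` to `z` on `[T, T + 1]`. -/
noncomputable def extendBySegment (T : ℝ) (γ : ℝ → ℂ) (z : ℂ) (t : ℝ) : ℂ :=
  if t ≤ T then γ t else γ T + ((t - T : ℝ) : ℂ) * (z - γ T)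

lemma extendBySegment_of_le {T : ℝ} {γ : ℝ → ℂ} {z : ℂ} {t : ℝ} (h : t ≤ T) :
    extendBySegment T γ z t = γ t := if_pos h

lemma extendBySegment_of_ge {T : ℝ} {γ : ℝ → ℂ} {z : ℂ} {t : ℝ} (h : T ≤ t) :
    extendBySegment T γ z t = γ T + ((t - T : ℝ) : ℂ) * (z - γ T) := by
  rcases h.eq_or_lt with rfl | h
  · simp [extendBySegment]
  · exact if_neg (not_le.2 h)

lemma lipschitzOnWith_segment (c v : ℂ) (T : ℝ) (s : Set ℝ) :
    LipschitzOnWith ‖v‖₊ (fun t : ℝ => c + ((t - T : ℝ) : ℂ) * v) s := by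
  refine LipschitzOnWith.of_dist_le_mul fun a _ b _ => le_of_eq ?_
  rw [dist_add_left, dist_eq_norm, ← sub_mul, ← Complex.ofReal_sub, norm_mul, Complex.norm_real,
    sub_sub_sub_cancel_right, Real.dist_eq, Real.norm_eq_abs, mul_comm, coe_nnnorm]

lemma lipschitzOnWith_Icc_of_le {f : ℝ → ℂ} {a b c : ℝ} {K : ℝ≥0}
    (h₁ : LipschitzOnWith K f (Icc a b)) (h₂ : LipschitzOnWith K f (Icc b c)) :
    LipschitzOnWith K f (Icc a c) := by
  have key : ∀ s ∈ Icc a c, ∀ t ∈ Icc a c, s ≤ t → dist (f s) (f t) ≤ K * dist s t := by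
    intro s hs t ht hst
    rcases le_total t b with htb | hbt
    · exact h₁.dist_le_mul s ⟨hs.1, hst.trans htb⟩ t ⟨ht.1, htb⟩
    rcases le_total b s with hbs | hsb
    · exact h₂.dist_le_mul s ⟨hbs, hs.2⟩ t ⟨hbt, ht.2⟩
    have e₁ := h₁.dist_le_mul s ⟨hs.1, hsb⟩ b ⟨hs.1.trans hsb, le_rfl⟩
    have e₂ := h₂.dist_le_mul b ⟨le_rfl, hbt.trans ht.2⟩ t ⟨hbt, ht.2⟩
    have e₃ : dist s t = dist s b + dist b t := by
      rw [dist_comm s t, dist_comm s b, dist_comm b t, Real.dist_eq, Real.dist_eq, Real.dist_eq,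
        abs_of_nonneg (by linarith), abs_of_nonneg (by linarith), abs_of_nonneg (by linarith)]
      ring
    calc dist (f s) (f t) ≤ dist (f s) (f b) + dist (f b) (f t) := dist_triangle _ _ _
      _ ≤ K * dist s t := by rw [e₃, mul_add]; exact add_le_add e₁ e₂
  refine LipschitzOnWith.of_dist_le_mul fun s hs t ht => ?_
  rcases le_total s t with h | h
  · exact key s hs t ht h
  · rw [dist_comm, dist_comm s]
    exact key t ht s hs h

/-- An allowed path can be continued along every sufficiently short segment. -/
lemma IsAllowedPath.exists_extendBySegment {T : ℝ} {γ : ℝ → ℂ} (h : Ω.IsAllowedPath T γ) :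
    ∃ ε > 0, ∀ z ∈ Metric.ball (γ T) ε, Ω.IsAllowedPath (T + 1) (extendBySegment T γ z) := by
  obtain ⟨K, hK⟩ := h.lipschitz
  obtain ⟨ε, hε, hball⟩ := Metric.isOpen_iff.1 Ω.isOpen_allowedSet _
    (h.mem_allowedSet T (right_mem_Icc.2 h.nonneg))
  refine ⟨ε, hε, fun z hz => ?_⟩
  have hle : EqOn (extendBySegment T γ z) γ (Icc 0 T) := fun t ht => extendBySegment_of_le ht.2
  have hge : EqOn (extendBySegment T γ z) (fun t => γ T + ((t - T : ℝ) : ℂ) * (z - γ T))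
      (Icc T (T + 1)) := fun t ht => extendBySegment_of_ge ht.1
  refine ⟨h.nonneg.trans (by linarith), ⟨max K ‖z - γ T‖₊, ?_⟩, ?_, fun t ht => ?_⟩
  · refine lipschitzOnWith_Icc_of_le (b := T) ?_ ?_
    · intro s hs t ht
      rw [hle hs, hle ht]
      exact hK.weaken (le_max_left _ _) hs ht
    · intro s hs t ht
      rw [hge hs, hge ht]
      exact (lipschitzOnWith_segment (γ T) (z - γ T) T (Icc T (T + 1))).weaken
        (le_max_right _ _) hs ht
  · rw [extendBySegment_of_le h.nonneg, h.map_zero]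
  · rcases le_total t T with htT | hTt
    · rw [eVariationOn.congr (hle.mono (Icc_subset_Icc_right htT)), extendBySegment_of_le htT]
      exact h.mem_allowedSet t ⟨ht.1, htT⟩
    · refine hball ?_
      -- the extension adds at most `|z - γ T|` to the length
      have h₁ : eVariationOn (extendBySegment T γ z) (Icc 0 T) = eVariationOn γ (Icc 0 T) :=
        eVariationOn.congr hle
      have h₁fin : eVariationOn γ (Icc 0 T) ≠ ⊤ := by
        have := (hK.locallyBoundedVariationOn 0 T (left_mem_Icc.2 h.nonneg)
          (right_mem_Icc.2 h.nonneg))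
        rwa [inter_self] at this
      have h₂ : eVariationOn (extendBySegment T γ z) (Icc T t) ≤ ENNReal.ofReal ‖z - γ T‖ := by
        rw [eVariationOn.congr (hge.mono (Icc_subset_Icc_right ht.2))]
        have := (lipschitzOnWith_segment (γ T) (z - γ T) T (Icc T t)).comp_eVariationOn_le
          (g := id) (mapsTo_id _)
        rw [Function.comp_id, eVariationOn_id_Icc] at this
        refine this.trans ?_
        calc (‖z - γ T‖₊ : ENNReal) * ENNReal.ofReal (t - T)
            ≤ ‖z - γ T‖₊ * 1 := by
              gcongr
              exact ENNReal.ofReal_le_one.2 (by linarith [ht.2])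
          _ = ENNReal.ofReal ‖z - γ T‖ := by
              rw [mul_one, ofReal_norm]; rfl
      have h₃ : eVariationOn (extendBySegment T γ z) (Icc 0 t) =
          eVariationOn γ (Icc 0 T) + eVariationOn (extendBySegment T γ z) (Icc T t) := by
        have := eVariationOn.Icc_add_Icc (extendBySegment T γ z) (s := univ) h.nonneg hTt
          (mem_univ _)
        simp only [univ_inter] at this
        rw [← this, h₁]
      have hz' : ‖z - γ T‖ < ε := by simpa [dist_eq_norm] using hz
      rw [Metric.mem_ball, Prod.dist_eq, max_lt_iff]
      constructor
      · rw [h₃, ENNReal.toReal_add h₁fin (h₂.trans_lt ENNReal.ofReal_lt_top).ne, Real.dist_eq]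
        dsimp only
        rw [add_sub_cancel_left, abs_of_nonneg ENNReal.toReal_nonneg]
        exact (ENNReal.toReal_le_of_le_ofReal (norm_nonneg _) h₂).trans_lt hz'
      · dsimp only
        rw [extendBySegment_of_ge hTt, dist_eq_norm, add_sub_cancel_left, norm_mul,
          Complex.norm_real, Real.norm_eq_abs, abs_of_nonneg (by linarith)]
        exact (mul_le_of_le_one_left (norm_nonneg _) (by linarith [ht.2])).trans_lt hz'

/-- An allowed path with its interval of definition. The universe parameter is a device: the
quotients of this type have to live in the same universe as the surfaces they are compared with. -/
structure AllowedPath (Ω : DiscreteFilteredSet) : Type u where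
  /-- the right end of the interval of definition -/
  T : ℝ
  /-- the path -/
  path : ℝ → ℂ
  isAllowed : Ω.IsAllowedPath T path

namespace AllowedPath

/-- The end point of an allowed path. -/
def target (a : AllowedPath.{u} Ω) : ℂ := a.path a.T

/-- A radius such that the path extends along all segments that are shorter. -/
noncomputable def radius (a : AllowedPath.{u} Ω) : ℝ :=
  a.isAllowed.exists_extendBySegment.choose

lemma radius_pos (a : AllowedPath.{u} Ω) : 0 < a.radius :=
  a.isAllowed.exists_extendBySegment.choose_spec.1

lemma isAllowedPath_extendBySegment (a : AllowedPath.{u} Ω) {z : ℂ}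
    (hz : z ∈ Metric.ball a.target a.radius) :
    Ω.IsAllowedPath (a.T + 1) (extendBySegment a.T a.path z) :=
  a.isAllowed.exists_extendBySegment.choose_spec.2 z hz

/-- The path `a` followed by the segment to `z`, and `a` itself if `z` is too far away. -/
noncomputable def extend (a : AllowedPath.{u} Ω) (z : ℂ) : AllowedPath.{u} Ω :=
  open Classical in
  if hz : z ∈ Metric.ball a.target a.radius then
    ⟨a.T + 1, extendBySegment a.T a.path z, a.isAllowedPath_extendBySegment hz⟩
  else a

lemma extend_of_mem (a : AllowedPath.{u} Ω) {z : ℂ} (hz : z ∈ Metric.ball a.target a.radius) :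
    a.extend z = ⟨a.T + 1, extendBySegment a.T a.path z, a.isAllowedPath_extendBySegment hz⟩ :=
  dif_pos hz

lemma target_extend (a : AllowedPath.{u} Ω) {z : ℂ} (hz : z ∈ Metric.ball a.target a.radius) :
    (a.extend z).target = z := by
  rw [extend_of_mem a hz, target]
  dsimp only
  rw [extendBySegment_of_ge (by linarith)]
  simp

lemma target_mem_ball (a : AllowedPath.{u} Ω) : a.target ∈ Metric.ball a.target a.radius :=
  Metric.mem_ball_self a.radius_pos

end AllowedPath

end DiscreteFilteredSet

open DiscreteFilteredSet

namespace EndlessRiemannSurface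

variable {Ω : DiscreteFilteredSet} (Y : EndlessRiemannSurface.{u} Ω)

/-! ### End points of lifts -/

lemma exists_isLift {T : ℝ} {γ : ℝ → ℂ} (h : Ω.IsAllowedPath T γ) : ∃ l, Y.IsLift T γ l := by
  rcases h.nonneg.eq_or_lt with rfl | hT
  · refine ⟨fun _ => Y.base, continuousOn_const, rfl, fun t ht => ?_⟩
    rw [le_antisymm ht.2 ht.1, Y.proj_base, h.map_zero]
  have hmaps : MapsTo (fun t => t * T) (Icc 0 1) (Icc 0 T) := fun t ht =>
    ⟨mul_nonneg ht.1 hT.le, mul_le_of_le_one_left hT.le ht.2⟩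
  have hall : Ω.IsAllowedPath 1 (fun t => γ (t * T)) := by
    refine ⟨zero_le_one, ?_, by simpa using h.map_zero, fun t ht => ?_⟩
    · obtain ⟨K, hK⟩ := h.lipschitz
      refine ⟨K * T.toNNReal, hK.comp (LipschitzOnWith.of_dist_le_mul fun s _ t _ => ?_) hmaps⟩
      rw [Real.dist_eq, Real.dist_eq, ← sub_mul, abs_mul, abs_of_pos hT, mul_comm,
        Real.coe_toNNReal _ hT.le]
    · have himage : (fun t => t * T) '' Icc 0 t = Icc 0 (t * T) := by
        rw [Set.image_mul_right_Icc ht.1 hT.le, zero_mul]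
      have hvar : eVariationOn (fun t => γ (t * T)) (Icc 0 t) = eVariationOn γ (Icc 0 (t * T)) := by
        rw [← himage]
        exact eVariationOn.comp_eq_of_monotoneOn γ (fun t => t * T)
          fun a _ b _ hab => mul_le_mul_of_nonneg_right hab hT.le
      rw [hvar]
      exact h.mem_allowedSet _ (hmaps ht)
  obtain ⟨l, hl, hl0, hproj⟩ := Y.exists_lift _ hall
  have hmaps' : MapsTo (fun t => t / T) (Icc 0 T) (Icc 0 1) := fun t ht =>
    ⟨div_nonneg ht.1 hT.le, (div_le_one hT).2 ht.2⟩
  refine ⟨fun t => l (t / T), hl.comp (by fun_prop) hmaps', by simpa using hl0, fun t ht => ?_⟩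
  rw [hproj _ (hmaps' ht), div_mul_cancel₀ _ hT.ne']

/-- The end point of the lift to `Y` of an allowed path. -/
noncomputable def endpoint (a : AllowedPath.{u} Ω) : Y.carrier :=
  (Y.exists_isLift a.isAllowed).choose a.T

variable {Y} in
lemma IsLift.eq_endpoint {a : AllowedPath.{u} Ω} {l : ℝ → Y.carrier} (h : Y.IsLift a.T a.path l) :
    l a.T = Y.endpoint a :=
  h.eqOn (Y.exists_isLift a.isAllowed).choose_spec (eqOn_refl _ _)
    (right_mem_Icc.2 a.isAllowed.nonneg)

lemma proj_endpoint (a : AllowedPath.{u} Ω) : Y.proj (Y.endpoint a) = a.target :=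
  (Y.exists_isLift a.isAllowed).choose_spec.proj_eq _ (right_mem_Icc.2 a.isAllowed.nonneg)

/-- The section of the projection over a disk around the end point of `a` that is obtained by
lifting the extensions of `a` by segments. The radius of the disk does not depend on `Y`. -/
noncomputable def localSection (a : AllowedPath.{u} Ω) (z : ℂ) : Y.carrier :=
  Y.endpoint (a.extend z)

lemma proj_localSection (a : AllowedPath.{u} Ω) {z : ℂ}
    (hz : z ∈ Metric.ball a.target a.radius) : Y.proj (Y.localSection a z) = z := by
  rw [localSection, proj_endpoint, a.target_extend hz]

variable {Y} in
lemma IsLift.extendBySegment_apply {a : AllowedPath.{u} Ω} {z : ℂ} {l : ℝ → Y.carrier}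
    (h : Y.IsLift (a.T + 1) (extendBySegment a.T a.path z) l) : l a.T = Y.endpoint a := by
  have hl := h.mono (T' := a.T) (by linarith)
  refine IsLift.eq_endpoint ⟨hl.continuousOn, hl.map_zero, fun t ht => ?_⟩
  rw [hl.proj_eq t ht, extendBySegment_of_le ht.2]

variable {Y} in
lemma IsLift.extendBySegment_apply_add_one {a : AllowedPath.{u} Ω} {z : ℂ} {l : ℝ → Y.carrier}
    (hz : z ∈ Metric.ball a.target a.radius)
    (h : Y.IsLift (a.T + 1) (extendBySegment a.T a.path z) l) :
    l (a.T + 1) = Y.localSection a z := by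
  rw [localSection, a.extend_of_mem hz]
  exact h.eq_endpoint
    (a := ⟨a.T + 1, extendBySegment a.T a.path z, a.isAllowedPath_extendBySegment hz⟩)

lemma localSection_target (a : AllowedPath.{u} Ω) :
    Y.localSection a a.target = Y.endpoint a := by
  obtain ⟨l, hl⟩ := Y.exists_isLift (a.isAllowedPath_extendBySegment a.target_mem_ball)
  have h0 := a.isAllowed.nonneg
  rw [← hl.extendBySegment_apply, ← hl.extendBySegment_apply_add_one a.target_mem_ball]
  -- on `[T, T + 1]` the extended path is constant, hence so is its lift
  have hsub : Icc a.T (a.T + 1) ⊆ Icc 0 (a.T + 1) := Icc_subset_Icc_left h0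
  refine Y.isSeparatedMap_proj.constOn_of_comp Y.isLocallyInjective_proj isPreconnected_Icc
    (hl.continuousOn.mono hsub) ?_ (right_mem_Icc.2 (by linarith)) (left_mem_Icc.2 (by linarith))
  have hconst : ∀ t ∈ Icc a.T (a.T + 1), Y.proj (l t) = a.target := fun t ht => by
    rw [hl.proj_eq t (hsub ht), extendBySegment_of_ge ht.1]
    simp [AllowedPath.target]
  exact fun s hs t ht => (hconst s hs).trans (hconst t ht).symm

/-- By the continuity of lifts of homotopies, applied to the homotopy that shrinks the disk to its
centre. -/
lemma continuousOn_localSection (a : AllowedPath.{u} Ω) :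
    ContinuousOn (Y.localSection a) (Metric.ball a.target a.radius) := by
  choose l hl using fun z : Metric.ball a.target a.radius =>
    Y.exists_isLift (a.isAllowedPath_extendBySegment z.2)
  have h0 := a.isAllowed.nonneg
  have hmem : ∀ t : unitInterval, a.T + t ∈ Icc 0 (a.T + 1) := fun t =>
    ⟨add_nonneg h0 t.2.1, by linarith [t.2.2]⟩
  let f : C(unitInterval × Metric.ball a.target a.radius, ℂ) :=
    ⟨fun x => a.target + ((x.1 : ℝ) : ℂ) * ((x.2 : ℂ) - a.target), by fun_prop⟩
  let g : unitInterval × Metric.ball a.target a.radius → Y.carrier := fun x => l x.2 (a.T + x.1)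
  have hg : Continuous g := by
    refine Y.isLocalDiffeomorph_proj.isLocalHomeomorph.continuous_lift Y.isSeparatedMap_proj f ?_
      ?_ fun z => ?_
    · funext x
      change Y.proj (l x.2 (a.T + x.1)) = _
      rw [(hl x.2).proj_eq _ (hmem x.1), extendBySegment_of_ge (by linarith [x.1.2.1])]
      simp [f, AllowedPath.target]
      rfl
    · have : (fun z => g (0, z)) = fun _ => Y.endpoint a := by
        funext z
        simpa [g] using (hl z).extendBySegment_apply
      rw [this]
      exact continuous_const
    · exact (hl z).continuousOn.comp_continuous (by fun_prop) hmem
  rw [continuousOn_iff_continuous_domRestrict]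
  have : (Metric.ball a.target a.radius).domRestrict (Y.localSection a) = fun z => g (1, z) := by
    funext z
    simpa [g] using ((hl z).extendBySegment_apply_add_one z.2).symm
  rw [this]
  fun_prop

/-- A continuous map to `Y` over the disk of `a` takes its values in the local section if one of
its values is there. -/
lemma eqOn_localSection {A : Type*} [TopologicalSpace A] {s : Set A} {f : A → Y.carrier}
    (a : AllowedPath.{u} Ω) (hs : IsPreconnected s) (hf : ContinuousOn f s)
    (hball : ∀ x ∈ s, Y.proj (f x) ∈ Metric.ball a.target a.radius) {x₀ : A} (hx₀ : x₀ ∈ s)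
    (h : f x₀ = Y.localSection a (Y.proj (f x₀))) :
    EqOn f (fun x => Y.localSection a (Y.proj (f x))) s :=
  Y.eqOn_of_proj_eq hs hf
    ((Y.continuousOn_localSection a).comp (Y.continuous_proj.comp_continuousOn hf) hball)
    (fun x hx => (Y.proj_localSection a (hball x hx)).symm) hx₀ h

end EndlessRiemannSurface

/-! ### The universal endless Riemann surface -/

namespace DiscreteFilteredSet

variable (Ω : DiscreteFilteredSet)

/-- Two allowed paths are identified if they end at the same point and if, in every `Ω`-endless
Riemann surface, their lifts end at the same point. -/
instance continuationSetoid : Setoid (AllowedPath.{u} Ω) where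
  r a b := a.target = b.target ∧
    ∀ Y : EndlessRiemannSurface.{u} Ω, Y.endpoint a = Y.endpoint b
  iseqv :=
    { refl := fun _ => ⟨rfl, fun _ => rfl⟩
      symm := fun h => ⟨h.1.symm, fun Y => (h.2 Y).symm⟩
      trans := fun h h' => ⟨h.1.trans h'.1, fun Y => (h.2 Y).trans (h'.2 Y)⟩ }

/-- The points of the universal surface: classes of allowed paths. -/
def UniversalPoint : Type u := Quotient (continuationSetoid.{u} Ω)

namespace UniversalPoint

variable {Ω}

/-- The class of an allowed path. -/
def mk (a : AllowedPath.{u} Ω) : UniversalPoint.{u} Ω := Quotient.mk _ a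

/-- The end point in `ℂ` of the paths in a class. -/
def proj : UniversalPoint.{u} Ω → ℂ := Quotient.lift AllowedPath.target fun _ _ h => h.1

/-- The end point in `Y` of the lifts of the paths in a class. -/
noncomputable def eval (Y : EndlessRiemannSurface.{u} Ω) : UniversalPoint.{u} Ω → Y.carrier :=
  Quotient.lift Y.endpoint fun _ _ h => h.2 Y

@[simp] lemma proj_mk (a : AllowedPath.{u} Ω) : proj (mk a) = a.target := rfl

@[simp] lemma eval_mk (Y : EndlessRiemannSurface.{u} Ω) (a : AllowedPath.{u} Ω) :
    eval Y (mk a) = Y.endpoint a := rfl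

lemma ext' {x y : UniversalPoint.{u} Ω} (h : x.proj = y.proj)
    (h' : ∀ Y : EndlessRiemannSurface.{u} Ω, x.eval Y = y.eval Y) : x = y := by
  induction x using Quotient.inductionOn
  induction y using Quotient.inductionOn
  exact Quotient.sound ⟨h, h'⟩

/-- A path in the class `x`. -/
noncomputable def rep (x : UniversalPoint.{u} Ω) : AllowedPath.{u} Ω := Quotient.out x

lemma mk_rep (x : UniversalPoint.{u} Ω) : mk x.rep = x := Quotient.out_eq x

lemma target_rep (x : UniversalPoint.{u} Ω) : x.rep.target = x.proj := by
  conv_rhs => rw [← x.mk_rep, proj_mk]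

lemma endpoint_rep (Y : EndlessRiemannSurface.{u} Ω) (x : UniversalPoint.{u} Ω) :
    Y.endpoint x.rep = x.eval Y := by
  conv_rhs => rw [← x.mk_rep, eval_mk]

lemma proj_eval (Y : EndlessRiemannSurface.{u} Ω) (x : UniversalPoint.{u} Ω) :
    Y.proj (x.eval Y) = x.proj := by
  rw [← endpoint_rep, Y.proj_endpoint, target_rep]

/-- The disk over which the local section through `x` is defined. -/
def disk (x : UniversalPoint.{u} Ω) : Set ℂ := Metric.ball x.rep.target x.rep.radius

lemma disk_mem_nhds (x : UniversalPoint.{u} Ω) : x.disk ∈ 𝓝 x.proj := by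
  rw [← target_rep]
  exact Metric.ball_mem_nhds _ x.rep.radius_pos

lemma proj_mem_disk (x : UniversalPoint.{u} Ω) : x.proj ∈ x.disk := mem_of_mem_nhds x.disk_mem_nhds

/-- The local section through `x`. -/
noncomputable def sec (x : UniversalPoint.{u} Ω) (z : ℂ) : UniversalPoint.{u} Ω :=
  mk (x.rep.extend z)

lemma proj_sec {x : UniversalPoint.{u} Ω} {z : ℂ} (hz : z ∈ x.disk) : (x.sec z).proj = z :=
  x.rep.target_extend hz

lemma eval_sec (Y : EndlessRiemannSurface.{u} Ω) (x : UniversalPoint.{u} Ω) (z : ℂ) :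
    (x.sec z).eval Y = Y.localSection x.rep z := rfl

lemma eval_eq_localSection (Y : EndlessRiemannSurface.{u} Ω) (x : UniversalPoint.{u} Ω) :
    x.eval Y = Y.localSection x.rep x.proj := by
  rw [← target_rep, Y.localSection_target, endpoint_rep]

lemma sec_proj (x : UniversalPoint.{u} Ω) : x.sec x.proj = x :=
  ext' (proj_sec x.proj_mem_disk) fun Y => (x.eval_eq_localSection Y).symm

/-- The local sections through `x` and through `x.sec z` agree on the intersection of their disks:
this intersection is connected, and in every endless surface the two local sections agree at `z`. -/
lemma sec_sec {x : UniversalPoint.{u} Ω} {z w : ℂ} (hz : z ∈ x.disk) (hw : w ∈ x.disk)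
    (hw' : w ∈ (x.sec z).disk) : (x.sec z).sec w = x.sec w := by
  refine ext' ((proj_sec hw').trans (proj_sec hw).symm) fun Y => ?_
  rw [eval_sec, eval_sec]
  have hz' : z ∈ (x.sec z).disk := by simpa [proj_sec hz] using (x.sec z).proj_mem_disk
  refine Y.eqOn_of_proj_eq (s := x.disk ∩ (x.sec z).disk)
    ((convex_ball _ _).inter (convex_ball _ _)).isPreconnected
    ((Y.continuousOn_localSection _).mono inter_subset_right)
    ((Y.continuousOn_localSection _).mono inter_subset_left)
    (fun v hv => (Y.proj_localSection _ hv.2).trans (Y.proj_localSection _ hv.1).symm)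
    ⟨hz, hz'⟩ ?_ ⟨hw, hw'⟩
  rw [← eval_sec Y x z, (x.sec z).eval_eq_localSection, proj_sec hz]

lemma eventually_sec_ne_sec {x y : UniversalPoint.{u} Ω} (h : x.proj = y.proj) (hne : x ≠ y) :
    ∀ᶠ z in 𝓝 x.proj, x.sec z ≠ y.sec z := by
  obtain ⟨Y, hY⟩ : ∃ Y : EndlessRiemannSurface.{u} Ω, x.eval Y ≠ y.eval Y := by
    by_contra! hcon
    exact hne (ext' h hcon)
  have hx : ContinuousAt (Y.localSection x.rep) x.proj :=
    (Y.continuousOn_localSection _).continuousAt x.disk_mem_nhds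
  have hy : ContinuousAt (Y.localSection y.rep) x.proj :=
    (Y.continuousOn_localSection _).continuousAt (h ▸ y.disk_mem_nhds)
  have hlim : Y.localSection x.rep x.proj ≠ Y.localSection y.rep x.proj := by
    rwa [← eval_eq_localSection, h, ← eval_eq_localSection]
  filter_upwards [(hx.ne_iff_eventually_ne hy).1 hlim] with z hz hcon
  exact hz (congrArg (eval Y) hcon)

end UniversalPoint

/-- The local sections that define the universal surface. -/
noncomputable def universalSystem : LocalSectionSystem (UniversalPoint.{u} Ω) where
  proj := UniversalPoint.proj
  sec := UniversalPoint.sec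
  sec_proj := UniversalPoint.sec_proj
  proj_sec x := by
    filter_upwards [x.disk_mem_nhds] with z hz using UniversalPoint.proj_sec hz
  sec_sec x := by
    filter_upwards [eventually_mem_nhds_iff.2 x.disk_mem_nhds] with z hz
    have hz' := (x.sec z).disk_mem_nhds
    rw [UniversalPoint.proj_sec (mem_of_mem_nhds hz)] at hz'
    filter_upwards [hz, hz'] with w hw hw'
    exact UniversalPoint.sec_sec (mem_of_mem_nhds hz) hw hw'
  sec_ne_sec _ _ := UniversalPoint.eventually_sec_ne_sec

namespace UniversalPoint

variable {Ω}

/-- The class of the constant path. -/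
def base (Ω : DiscreteFilteredSet) : UniversalPoint.{u} Ω :=
  mk ⟨0, fun _ => 0, Ω.isAllowedPath_zero⟩

/-- The class of the restriction to `[0, t]` of an allowed path `γ` on `[0, T]`; the base point, as
a junk value, if `t ∉ [0, T]`. -/
noncomputable def track {T : ℝ} {γ : ℝ → ℂ} (h : Ω.IsAllowedPath T γ) (t : ℝ) :
    UniversalPoint.{u} Ω :=
  open Classical in
  if ht : t ∈ Icc 0 T then mk ⟨t, γ, h.mono ht.1 ht.2⟩ else base.{u} Ω

lemma track_of_mem {T : ℝ} {γ : ℝ → ℂ} (h : Ω.IsAllowedPath T γ) {t : ℝ} (ht : t ∈ Icc 0 T) :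
    track h t = mk.{u} ⟨t, γ, h.mono ht.1 ht.2⟩ := dif_pos ht

lemma proj_track {T : ℝ} {γ : ℝ → ℂ} (h : Ω.IsAllowedPath T γ) {t : ℝ} (ht : t ∈ Icc 0 T) :
    proj (track.{u} h t) = γ t := by
  rw [track_of_mem h ht]
  rfl

lemma eval_track {Y : EndlessRiemannSurface.{u} Ω} {T : ℝ} {γ : ℝ → ℂ} (h : Ω.IsAllowedPath T γ)
    {l : ℝ → Y.carrier} (hl : Y.IsLift T γ l) {t : ℝ} (ht : t ∈ Icc 0 T) :
    eval Y (track h t) = l t := by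
  rw [track_of_mem h ht, eval_mk]
  exact ((hl.mono ht.2).eq_endpoint (a := ⟨t, γ, h.mono ht.1 ht.2⟩)).symm

lemma track_zero {T : ℝ} {γ : ℝ → ℂ} (h : Ω.IsAllowedPath T γ) : track h 0 = base.{u} Ω := by
  have h0 : (0 : ℝ) ∈ Icc 0 T := left_mem_Icc.2 h.nonneg
  refine ext' ((proj_track h h0).trans h.map_zero) fun Y => ?_
  obtain ⟨l, hl⟩ := Y.exists_isLift h
  obtain ⟨l', hl'⟩ := Y.exists_isLift Ω.isAllowedPath_zero
  rw [eval_track h hl h0, hl.map_zero]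
  exact hl'.map_zero.symm.trans (hl'.eq_endpoint (a := ⟨0, fun _ => 0, Ω.isAllowedPath_zero⟩))

lemma continuousOn_track {T : ℝ} {γ : ℝ → ℂ} (h : Ω.IsAllowedPath T γ) :
    ContinuousOn (Y := Ω.universalSystem.Space) (track.{u} h) (Icc 0 T) := by
  intro t₀ ht₀
  have hproj : ∀ t ∈ Icc 0 T, proj (track.{u} h t) = γ t := fun t => proj_track h
  refine Ω.universalSystem.continuousWithinAt_of_eventually_eq
    ((h.continuousOn t₀ ht₀).congr hproj (hproj t₀ ht₀)) ?_
  have hdisk : disk (track.{u} h t₀) ∈ 𝓝 (γ t₀) := hproj t₀ ht₀ ▸ disk_mem_nhds _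
  obtain ⟨δ, hδ, hball⟩ := Metric.mem_nhdsWithin_iff.1 (h.continuousOn t₀ ht₀ hdisk)
  refine Metric.mem_nhdsWithin_iff.2 ⟨δ, hδ, fun t ht => ?_⟩
  have hmem : γ t ∈ disk (track.{u} h t₀) := hball ht
  change track h t = sec (track h t₀) (proj (track h t))
  rw [hproj t ht.2]
  refine ext' ((hproj t ht.2).trans (proj_sec hmem).symm) fun Y => ?_
  -- in each endless surface the lift of `γ` stays in the local section while `γ` is in the disk
  obtain ⟨l, hl⟩ := Y.exists_isLift h
  rw [eval_sec, eval_track h hl ht.2]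
  have hpre : IsPreconnected (Metric.ball t₀ δ ∩ Icc 0 T) :=
    ((convex_ball _ _).inter (convex_Icc _ _)).isPreconnected
  have := Y.eqOn_localSection (rep (track h t₀)) hpre (hl.continuousOn.mono inter_subset_right)
    (fun s hs => by rw [hl.proj_eq s hs.2]; exact hball hs)
    ⟨Metric.mem_ball_self hδ, ht₀⟩ ?_ ht
  · exact this.trans (by simp only [hl.proj_eq t ht.2])
  · rw [hl.proj_eq t₀ ht₀, ← eval_track h hl ht₀, eval_eq_localSection, hproj t₀ ht₀]

lemma joinedIn_base (x : UniversalPoint.{u} Ω) :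
    JoinedIn (X := Ω.universalSystem.Space) univ (base Ω) x := by
  rw [← mk_rep x]
  generalize rep x = a
  have h := a.isAllowed
  have hJ : JoinedIn (X := Ω.universalSystem.Space) univ (track.{u} h 0) (track.{u} h a.T) :=
    ⟨⟨⟨fun s => track.{u} h (s * a.T), (continuousOn_track h).comp_continuous (by fun_prop)
        fun s => ⟨mul_nonneg s.2.1 h.nonneg, mul_le_of_le_one_left h.nonneg s.2.2⟩⟩,
      congrArg (track h) (zero_mul _), congrArg (track h) (one_mul _)⟩, fun _ => trivial⟩
  rwa [track_zero, track_of_mem h (right_mem_Icc.2 h.nonneg)] at hJ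

instance : PathConnectedSpace Ω.universalSystem.Space where
  nonempty := ⟨base Ω⟩
  joined x y := joinedIn_univ.1 ((joinedIn_base x).symm.trans (joinedIn_base y))

end UniversalPoint

/-- The universal `Ω`-endless Riemann surface. -/
noncomputable def universalSurface : EndlessRiemannSurface.{u} Ω where
  carrier := Ω.universalSystem.Space
  proj := Ω.universalSystem.projSpace
  isLocalDiffeomorph_proj := Ω.universalSystem.isLocalDiffeomorph_projSpace
  base := UniversalPoint.base Ω
  proj_base := rfl
  exists_lift _ hγ := ⟨UniversalPoint.track hγ, UniversalPoint.continuousOn_track hγ,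
    UniversalPoint.track_zero hγ, fun _ ht => UniversalPoint.proj_track hγ ht⟩

variable {Ω}

lemma continuous_eval (Y : EndlessRiemannSurface.{u} Ω) :
    Continuous (X := Ω.universalSystem.Space) (UniversalPoint.eval Y) := by
  refine ⟨fun U hU => Ω.universalSystem.isOpen_iff.2 fun (x : UniversalPoint Ω) hx => ?_⟩
  have hc : ContinuousAt (Y.localSection x.rep) x.proj :=
    (Y.continuousOn_localSection _).continuousAt x.disk_mem_nhds
  exact hc (hU.mem_nhds (by rw [← UniversalPoint.eval_eq_localSection]; exact hx))

/-- The morphism to `Y` that sends the class of an allowed path to the end point of its lift. -/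
noncomputable def universalHom (Y : EndlessRiemannSurface.{u} Ω) :
    EndlessRiemannSurface.Hom Ω.universalSurface Y where
  toFun := UniversalPoint.eval Y
  isLocalDiffeomorph := (continuous_eval Y).isLocalDiffeomorph_of_proj_comp
    Ω.universalSurface.isLocalDiffeomorph_proj Y.isLocalDiffeomorph_proj (UniversalPoint.proj_eval Y)
  proj_comp := UniversalPoint.proj_eval Y
  map_base := by
    obtain ⟨l, hl⟩ := Y.exists_isLift Ω.isAllowedPath_zero
    exact (hl.eq_endpoint (a := ⟨0, fun _ => 0, Ω.isAllowedPath_zero⟩)).symm.trans hl.map_zero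

end DiscreteFilteredSet

/-- Two morphisms are lifts of the same projection that agree at the base point. -/
lemma EndlessRiemannSurface.hom_eq {Ω : DiscreteFilteredSet} {X Y : EndlessRiemannSurface.{u} Ω}
    (f g : Hom X Y) : f = g := by
  ext x
  exact Y.eqOn_of_proj_eq isPreconnected_univ
    f.isLocalDiffeomorph.isLocalHomeomorph.continuous.continuousOn
    g.isLocalDiffeomorph.isLocalHomeomorph.continuous.continuousOn
    (fun a _ => (f.proj_comp a).trans (g.proj_comp a).symm) (mem_univ X.base)
    (f.map_base.trans g.map_base.symm) (mem_univ x)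

/-! ### The universal cover of an endless Riemann surface -/

lemma Path.Homotopic.Quotient.cast_trans_left {X : Type*} [TopologicalSpace X] {x x' y z : X}
    (h : x' = x) (α : Path.Homotopic.Quotient x y) (β : Path.Homotopic.Quotient y z) :
    (α.cast h rfl).trans β = (α.trans β).cast h rfl := by
  subst h
  simp

lemma Path.Homotopic.Quotient.trans_right_cancel {X : Type*} [TopologicalSpace X] {x y z : X}
    {α α' : Path.Homotopic.Quotient x y} (β : Path.Homotopic.Quotient y z)
    (h : α.trans β = α'.trans β) : α = α' := by
  have := congrArg (fun γ => γ.trans β.symm) h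
  simpa using this

lemma Path.Homotopic.Quotient.trans_left_cancel {X : Type*} [TopologicalSpace X] {x y z : X}
    (α : Path.Homotopic.Quotient x y) {β β' : Path.Homotopic.Quotient y z}
    (h : α.trans β = α.trans β') : β = β' := by
  have := congrArg (fun γ => α.symm.trans γ) h
  simpa [← Path.Homotopic.Quotient.trans_assoc] using this

namespace EndlessRiemannSurface

variable {Ω : DiscreteFilteredSet} (X : EndlessRiemannSurface.{u} Ω)

/-- The inverse of the projection near `x`. -/
noncomputable def localInv (x : X.carrier) : ℂ → X.carrier :=
  (X.isLocalDiffeomorph_proj x).localInverse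

lemma exists_ball_localInv (x : X.carrier) : ∃ ε > 0,
    Metric.ball (X.proj x) ε ⊆ (X.isLocalDiffeomorph_proj x).localInverse.source :=
  Metric.isOpen_iff.1 (X.isLocalDiffeomorph_proj x).localInverse_open_source _
    (X.isLocalDiffeomorph_proj x).localInverse_mem_source

/-- A disk around `proj x` on which `localInv x` is a section. -/
noncomputable def localDisk (x : X.carrier) : Set ℂ :=
  Metric.ball (X.proj x) (X.exists_ball_localInv x).choose

lemma proj_mem_localDisk (x : X.carrier) : X.proj x ∈ X.localDisk x :=
  Metric.mem_ball_self (X.exists_ball_localInv x).choose_spec.1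

lemma isOpen_localDisk (x : X.carrier) : IsOpen (X.localDisk x) := Metric.isOpen_ball

lemma convex_localDisk (x : X.carrier) : Convex ℝ (X.localDisk x) := convex_ball _ _

lemma localDisk_subset (x : X.carrier) :
    X.localDisk x ⊆ (X.isLocalDiffeomorph_proj x).localInverse.source :=
  (X.exists_ball_localInv x).choose_spec.2

lemma continuousOn_localInv (x : X.carrier) : ContinuousOn (X.localInv x) (X.localDisk x) :=
  (X.isLocalDiffeomorph_proj x).localInverse_contMDiffOn.continuousOn.mono (X.localDisk_subset x)

lemma proj_localInv {x : X.carrier} {z : ℂ} (hz : z ∈ X.localDisk x) :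
    X.proj (X.localInv x z) = z :=
  (X.isLocalDiffeomorph_proj x).localInverse_right_inv (X.localDisk_subset x hz)

lemma localInv_proj (x : X.carrier) : X.localInv x (X.proj x) = x :=
  (X.isLocalDiffeomorph_proj x).localInverse_left_inv
    (X.isLocalDiffeomorph_proj x).localInverse_mem_target

/-- The neighbourhood of `x` that the projection maps bijectively to `localDisk x`. -/
noncomputable def sheet (x : X.carrier) : Set X.carrier := X.localInv x '' X.localDisk x

lemma mem_sheet_self (x : X.carrier) : x ∈ X.sheet x :=
  ⟨_, X.proj_mem_localDisk x, X.localInv_proj x⟩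

lemma isOpen_sheet (x : X.carrier) : IsOpen (X.sheet x) :=
  ((X.isLocalDiffeomorph_proj x).localInverse.toOpenPartialHomeomorph).isOpen_image_of_subset_source
    (X.isOpen_localDisk x) (X.localDisk_subset x)

lemma proj_mem_of_mem_sheet {x y : X.carrier} (hy : y ∈ X.sheet x) :
    X.proj y ∈ X.localDisk x := by
  obtain ⟨z, hz, rfl⟩ := hy
  rwa [X.proj_localInv hz]

lemma localInv_of_mem_sheet {x y : X.carrier} (hy : y ∈ X.sheet x) :
    X.localInv x (X.proj y) = y := by
  obtain ⟨z, hz, rfl⟩ := hy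
  rw [X.proj_localInv hz]

/-- A sheet is a copy of a disk, so two paths in it with the same end points are homotopic. -/
lemma homotopic_of_mem_sheet {x y y' : X.carrier} (P P' : Path y y') (hP : ∀ t, P t ∈ X.sheet x)
    (hP' : ∀ t, P' t ∈ X.sheet x) : P.Homotopic P' := by
  have hmem : ∀ s t : unitInterval, (1 - (s : ℝ)) • X.proj (P t) + (s : ℝ) • X.proj (P' t) ∈
      X.localDisk x := fun s t =>
    X.convex_localDisk x (X.proj_mem_of_mem_sheet (hP t)) (X.proj_mem_of_mem_sheet (hP' t))
      (sub_nonneg.2 s.2.2) s.2.1 (by ring)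
  have hc := X.continuous_proj
  refine ⟨{ toFun := fun st => X.localInv x
              ((1 - (st.1 : ℝ)) • X.proj (P st.2) + (st.1 : ℝ) • X.proj (P' st.2))
            continuous_toFun := (X.continuousOn_localInv x).comp_continuous (by fun_prop)
              fun st => hmem st.1 st.2
            map_zero_left := fun t => ?_
            map_one_left := fun t => ?_
            prop' := fun s t ht => ?_ }⟩
  · simpa using X.localInv_of_mem_sheet (hP t)
  · simpa using X.localInv_of_mem_sheet (hP' t)
  · have h : P t = P' t := by rcases ht with rfl | rfl <;> simp
    change X.localInv x ((1 - (s : ℝ)) • X.proj (P t) + (s : ℝ) • X.proj (P' t)) = P t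
    rw [← h, ← add_smul, sub_add_cancel, one_smul, X.localInv_of_mem_sheet (hP t)]

lemma joinedIn_localInv {x : X.carrier} {V : Set ℂ} (hV : Convex ℝ V) (hVx : V ⊆ X.localDisk x)
    {z w : ℂ} (hz : z ∈ V) (hw : w ∈ V) :
    JoinedIn (X.localInv x '' V) (X.localInv x z) (X.localInv x w) :=
  ((hV.isPathConnected ⟨z, hz⟩).image' ((X.continuousOn_localInv x).mono hVx)).joinedIn _
    (mem_image_of_mem _ hz) _ (mem_image_of_mem _ hw)

lemma joinedIn_sheet (x : X.carrier) {z : ℂ} (hz : z ∈ X.localDisk x) :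
    JoinedIn (X.sheet x) x (X.localInv x z) := by
  have := X.joinedIn_localInv (X.convex_localDisk x) subset_rfl (X.proj_mem_localDisk x) hz
  rwa [localInv_proj] at this

/-- The points of the universal cover: homotopy classes of paths from the base point. -/
abbrev CoverPoint : Type u := Σ x : X.carrier, Path.Homotopic.Quotient X.base x

/-- The local section of the universal cover: a path class is continued inside a sheet. -/
noncomputable def coverSec (p : X.CoverPoint) (z : ℂ) : X.CoverPoint :=
  open Classical in
  if hz : z ∈ X.localDisk p.1 then
    ⟨X.localInv p.1 z, p.2.trans (.mk (X.joinedIn_sheet p.1 hz).somePath)⟩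
  else p

lemma coverSec_of_mem {p : X.CoverPoint} {z : ℂ} (hz : z ∈ X.localDisk p.1) :
    X.coverSec p z =
      ⟨X.localInv p.1 z, p.2.trans (.mk (X.joinedIn_sheet p.1 hz).somePath)⟩ := dif_pos hz

lemma coverSec_proj {x y : X.carrier} (α : Path.Homotopic.Quotient X.base x) (P : Path x y)
    (hP : ∀ t, P t ∈ X.sheet x) :
    X.coverSec ⟨x, α⟩ (X.proj y) = ⟨y, α.trans (.mk P)⟩ := by
  obtain ⟨z, hz, rfl⟩ : y ∈ X.sheet x := by simpa using hP 1
  rw [X.proj_localInv hz, X.coverSec_of_mem (p := ⟨x, α⟩) hz]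
  congr 2
  exact Path.Homotopic.Quotient.eq.2
    (X.homotopic_of_mem_sheet _ _ (X.joinedIn_sheet x hz).somePath_mem hP)

lemma fst_coverSec {p : X.CoverPoint} {z : ℂ} (hz : z ∈ X.localDisk p.1) :
    (X.coverSec p z).1 = X.localInv p.1 z := by
  rw [X.coverSec_of_mem hz]

lemma localDisk_mem_nhds (x : X.carrier) : X.localDisk x ∈ 𝓝 (X.proj x) :=
  (X.isOpen_localDisk x).mem_nhds (X.proj_mem_localDisk x)

lemma continuousAt_localInv {x : X.carrier} {z : ℂ} (hz : z ∈ X.localDisk x) :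
    ContinuousAt (X.localInv x) z :=
  (X.continuousOn_localInv x).continuousAt ((X.isOpen_localDisk x).mem_nhds hz)

lemma eventually_coverSec_coverSec (p : X.CoverPoint) {z : ℂ} (hz : z ∈ X.localDisk p.1) :
    ∀ᶠ w in 𝓝 z, X.coverSec (X.coverSec p z) w = X.coverSec p w := by
  obtain ⟨x, α⟩ := p
  dsimp only at hz
  obtain ⟨y, hy, rfl⟩ : ∃ y, y ∈ X.sheet x ∧ X.proj y = z :=
    ⟨X.localInv x z, ⟨z, hz, rfl⟩, X.proj_localInv hz⟩
  obtain ⟨P, hP⟩ : JoinedIn (X.sheet x) x y := by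
    have := X.joinedIn_sheet x hz
    rwa [X.localInv_of_mem_sheet hy] at this
  rw [X.coverSec_proj α P hP]
  have hmem : X.localInv y ⁻¹' X.sheet x ∩ X.localDisk y ∈ 𝓝 (X.proj y) :=
    inter_mem (X.continuousAt_localInv (X.proj_mem_localDisk y)
      ((X.isOpen_sheet x).mem_nhds (by rwa [localInv_proj]))) (X.localDisk_mem_nhds y)
  obtain ⟨δ, hδ, hball⟩ := Metric.mem_nhds_iff.1 hmem
  filter_upwards [Metric.ball_mem_nhds _ hδ] with w hw
  -- over the ball of radius `δ` the sheet of `y` lies in the sheet of `x`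
  obtain ⟨P', hP'⟩ : JoinedIn (X.localInv y '' Metric.ball (X.proj y) δ) y (X.localInv y w) := by
    have := X.joinedIn_localInv (convex_ball _ _) (fun v hv => (hball hv).2)
      (Metric.mem_ball_self hδ) hw
    rwa [localInv_proj] at this
  have h₁ : ∀ t, P' t ∈ X.sheet x := fun t => by
    obtain ⟨v, hv, hvt⟩ := hP' t
    exact hvt ▸ (hball hv).1
  have h₂ : ∀ t, P' t ∈ X.sheet y := fun t => by
    obtain ⟨v, hv, hvt⟩ := hP' t
    exact hvt ▸ mem_image_of_mem _ (hball hv).2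
  have h₃ : ∀ t, P.trans P' t ∈ X.sheet x := fun t => by
    have ht : P.trans P' t ∈ range P ∪ range P' := by
      rw [← Path.trans_range]
      exact mem_range_self t
    rcases ht with ⟨s, hs⟩ | ⟨s, hs⟩
    · exact hs ▸ hP s
    · exact hs ▸ h₁ s
  have e₁ := X.coverSec_proj (α.trans (.mk P)) P' h₂
  have e₂ := X.coverSec_proj α (P.trans P') h₃
  rw [X.proj_localInv (hball hw).2] at e₁ e₂
  rw [e₁, e₂, Path.Homotopic.Quotient.mk_trans, Path.Homotopic.Quotient.trans_assoc]

lemma eventually_coverSec_ne {p q : X.CoverPoint} (h : X.proj p.1 = X.proj q.1) (hne : p ≠ q) :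
    ∀ᶠ z in 𝓝 (X.proj p.1), X.coverSec p z ≠ X.coverSec q z := by
  obtain ⟨x, α⟩ := p
  obtain ⟨y, β⟩ := q
  dsimp only at h ⊢
  by_cases hxy : x = y
  · subst hxy
    filter_upwards [X.localDisk_mem_nhds x] with z hz hcon
    rw [X.coverSec_of_mem (p := ⟨x, α⟩) hz, X.coverSec_of_mem (p := ⟨x, β⟩) hz] at hcon
    exact hne (congrArg (Sigma.mk x)
      (Path.Homotopic.Quotient.trans_right_cancel _ (eq_of_heq (Sigma.mk.inj hcon).2)))
  · have hx := X.continuousAt_localInv (X.proj_mem_localDisk x)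
    have hy := X.continuousAt_localInv (X.proj_mem_localDisk y)
    rw [← h] at hy
    have hlim : X.localInv x (X.proj x) ≠ X.localInv y (X.proj x) := by
      rwa [localInv_proj, h, localInv_proj]
    filter_upwards [(hx.ne_iff_eventually_ne hy).1 hlim, X.localDisk_mem_nhds x,
      h ▸ X.localDisk_mem_nhds y] with z hz hzx hzy hcon
    have := congrArg Sigma.fst hcon
    rw [X.fst_coverSec (p := ⟨x, α⟩) hzx, X.fst_coverSec (p := ⟨y, β⟩) hzy] at this
    exact hz this

/-- The local sections that define the universal cover. -/
noncomputable def coverSystem : LocalSectionSystem X.CoverPoint where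
  proj p := X.proj p.1
  sec := X.coverSec
  sec_proj p := by
    have := X.coverSec_proj p.2 (Path.refl p.1) fun _ => X.mem_sheet_self p.1
    rw [Path.Homotopic.Quotient.mk_refl, Path.Homotopic.Quotient.trans_refl] at this
    exact this
  proj_sec p := by
    filter_upwards [X.localDisk_mem_nhds p.1] with z hz
    rw [X.fst_coverSec hz, X.proj_localInv hz]
  sec_sec p := by
    filter_upwards [X.localDisk_mem_nhds p.1] with z hz
    exact X.eventually_coverSec_coverSec p hz
  sec_ne_sec _ _ := X.eventually_coverSec_ne

variable {X}

/-- The lift of the path `c` to the universal cover: the class of `c|[0,t]`, at time `t`. -/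
def coverTrack {x : X.carrier} (c : Path X.base x) (t : unitInterval) : X.CoverPoint :=
  ⟨c t, (Path.Homotopic.Quotient.mk (c.subpath 0 t)).cast c.source.symm rfl⟩

variable (X) in
/-- The base point of the universal cover: the class of the constant path. -/
def coverBase : X.CoverPoint := ⟨X.base, .refl X.base⟩

lemma coverTrack_zero {x : X.carrier} (c : Path X.base x) : coverTrack c 0 = X.coverBase := by
  have h := Path.Homotopic.Quotient.cast_heq c.source.symm rfl
    (γ := Path.Homotopic.Quotient.mk (c.subpath 0 0))
  have h' : HEq (Path.Homotopic.Quotient.refl (c 0)) (Path.Homotopic.Quotient.refl X.base) := by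
    rw [c.source]
  refine Sigma.ext c.source (h.trans ?_)
  rw [Path.subpath_self]
  exact h'

lemma coverTrack_one {x : X.carrier} (c : Path X.base x) :
    coverTrack c 1 = ⟨x, Path.Homotopic.Quotient.mk c⟩ := by
  have h := Path.Homotopic.Quotient.cast_heq c.source.symm rfl
    (γ := Path.Homotopic.Quotient.mk (c.subpath 0 1))
  refine Sigma.ext c.target (h.trans ?_)
  rw [Path.subpath_zero_one]
  exact Path.Homotopic.Quotient.cast_heq c.source c.target (γ := Path.Homotopic.Quotient.mk c)

lemma continuous_coverTrack {x : X.carrier} (c : Path X.base x) :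
    Continuous (Y := X.coverSystem.Space) (coverTrack c) := by
  refine continuousOn_univ.1 fun t₀ _ => ?_
  refine X.coverSystem.continuousWithinAt_of_eventually_eq
    (X.continuous_proj.comp c.continuous).continuousWithinAt ?_
  rw [nhdsWithin_univ]
  obtain ⟨δ, hδ, hball⟩ := Metric.mem_nhds_iff.1
    (c.continuous.continuousAt ((X.isOpen_sheet (c t₀)).mem_nhds (X.mem_sheet_self (c t₀))))
  filter_upwards [Metric.ball_mem_nhds t₀ hδ] with t ht
  have hsub : ∀ s, c.subpath t₀ t s ∈ X.sheet (c t₀) := fun s => by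
    have hs : c.subpath t₀ t s ∈ c '' uIcc t₀ t := by
      rw [← Path.range_subpath]
      exact mem_range_self s
    obtain ⟨r, hr, hrs⟩ := hs
    have hrt : dist r t₀ ≤ dist t t₀ := by
      have hr' : (r : ℝ) ∈ uIcc (t₀ : ℝ) t := by
        rw [mem_uIcc] at hr ⊢
        exact hr
      rw [Subtype.dist_eq, Subtype.dist_eq, Real.dist_eq, Real.dist_eq]
      exact abs_sub_left_of_mem_uIcc hr'
    exact hrs ▸ hball (hrt.trans_lt ht)
  have key := X.coverSec_proj ((Path.Homotopic.Quotient.mk (c.subpath 0 t₀)).cast c.source.symm rfl)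
    (c.subpath t₀ t) hsub
  rw [Path.Homotopic.Quotient.cast_trans_left, ← Path.Homotopic.Quotient.mk_trans,
    Path.Homotopic.Quotient.eq.2 ⟨Path.Homotopy.subpathTransSubpath c 0 t₀ t⟩] at key
  exact key.symm

lemma joinedIn_coverBase (p : X.CoverPoint) :
    JoinedIn (X := X.coverSystem.Space) univ X.coverBase p := by
  obtain ⟨x, α⟩ := p
  induction α with | mk c =>
  exact ⟨⟨⟨coverTrack c, continuous_coverTrack c⟩, coverTrack_zero c, coverTrack_one c⟩,
    fun _ => trivial⟩

instance : PathConnectedSpace X.coverSystem.Space where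
  nonempty := ⟨X.coverBase⟩
  joined x y := joinedIn_univ.1 ((joinedIn_coverBase x).symm.trans (joinedIn_coverBase y))

variable (X) in
/-- The universal cover of an endless Riemann surface, as an endless Riemann surface. -/
noncomputable def universalCover : EndlessRiemannSurface.{u} Ω where
  carrier := X.coverSystem.Space
  proj := X.coverSystem.projSpace
  isLocalDiffeomorph_proj := X.coverSystem.isLocalDiffeomorph_projSpace
  base := X.coverBase
  proj_base := X.proj_base
  exists_lift γ hγ := by
    obtain ⟨l, hl, hl0, hproj⟩ := X.exists_lift γ hγ
    let c : Path X.base (l 1) :=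
      ⟨⟨fun t => l t, hl.comp_continuous continuous_subtype_val fun t => t.2⟩, hl0, rfl⟩
    refine ⟨fun t => coverTrack c (projIcc 0 1 zero_le_one t),
      ((continuous_coverTrack c).comp continuous_projIcc).continuousOn, ?_, fun t ht => ?_⟩
    · exact (congrArg (coverTrack c) (projIcc_left _)).trans (coverTrack_zero c)
    · change X.proj (l (projIcc 0 1 zero_le_one t)) = γ t
      rw [projIcc_of_mem zero_le_one ht]
      exact hproj t ht

/-- If a surface has a morphism to its universal cover, two paths from the base point to `x` are
homotopic: the morphism lifts both of them, so both homotopy classes are its value at `x`. -/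
lemma homotopic_of_hom_universalCover (q : Hom X X.universalCover) {x : X.carrier}
    (c c' : Path X.base x) : c.Homotopic c' := by
  have key : ∀ c : Path X.base x,
      q.toFun x = (⟨x, Path.Homotopic.Quotient.mk c⟩ : X.CoverPoint) := by
    intro c
    have hq := q.isLocalDiffeomorph.isLocalHomeomorph.continuous
    have := X.universalCover.eqOn_of_proj_eq (f := fun t => q.toFun (c t)) (g := coverTrack c)
      (isPreconnected_univ (α := unitInterval)) (hq.comp c.continuous).continuousOn
      (continuous_coverTrack c).continuousOn (fun t _ => q.proj_comp (c t)) (mem_univ 0)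
      ((congrArg q.toFun c.source).trans (q.map_base.trans (coverTrack_zero c).symm))
      (mem_univ 1)
    dsimp only at this
    rw [c.target] at this
    exact this.trans (coverTrack_one c)
  have h := (key c).symm.trans (key c')
  exact Path.Homotopic.Quotient.eq.1 (eq_of_heq (Sigma.mk.inj h).2)

lemma simplyConnectedSpace_of_hom_universalCover [PathConnectedSpace X.carrier]
    (q : Hom X X.universalCover) : SimplyConnectedSpace X.carrier := by
  refine simply_connected_iff_paths_homotopic'.2 ⟨inferInstance, fun {x y} p₁ p₂ => ?_⟩
  have r := PathConnectedSpace.somePath X.base x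
  have h := Path.Homotopic.Quotient.eq.2
    (homotopic_of_hom_universalCover q (r.trans p₁) (r.trans p₂))
  rw [Path.Homotopic.Quotient.mk_trans, Path.Homotopic.Quotient.mk_trans] at h
  exact Path.Homotopic.Quotient.eq.1 (Path.Homotopic.Quotient.trans_left_cancel _ h)

end EndlessRiemannSurface

/-- For every d.f.s. `Ω` there is an `Ω`-endless Riemann surface `XΩ` with exactly one morphism
to every `Ω`-endless Riemann surface; any other such surface is isomorphic to `XΩ`, and `XΩ`
is simply connected. -/
theorem theorem3p2 (Ω : DiscreteFilteredSet) :
    ∃ XΩ : EndlessRiemannSurface.{u} Ω,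
      (∀ X : EndlessRiemannSurface.{u} Ω, ∃ q : XΩ ⟶ X, ∀ q' : XΩ ⟶ X, q' = q) ∧
      (∀ Y : EndlessRiemannSurface.{u} Ω,
        (∀ X : EndlessRiemannSurface.{u} Ω, ∃ q : Y ⟶ X, ∀ q' : Y ⟶ X, q' = q) →
          Nonempty (XΩ ≅ Y)) ∧
      SimplyConnectedSpace XΩ.carrier := by
  refine ⟨Ω.universalSurface, fun X => ⟨Ω.universalHom X, fun q' => ?_⟩, fun Y hY => ?_, ?_⟩
  · exact EndlessRiemannSurface.hom_eq _ _
  · obtain ⟨g, -⟩ := hY Ω.universalSurface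
    exact ⟨⟨Ω.universalHom Y, g, EndlessRiemannSurface.hom_eq _ _,
      EndlessRiemannSurface.hom_eq _ _⟩⟩
  · have : PathConnectedSpace Ω.universalSurface.carrier :=
      inferInstanceAs (PathConnectedSpace Ω.universalSystem.Space)
    exact EndlessRiemannSurface.simplyConnectedSpace_of_hom_universalCover (Ω.universalHom _)
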